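/- Let $d\ge 1$, $I=[0,1]^d$ with Lebesgue measure $\lambda_0$, $V=L^2(I;\mathbb R^d)$ with norm $\|\cdot\|$, $\Lambda=\{z\in V:\ z(i)\in\mathbb Z^d \text{ for a.e. } i\in I\}$, and let $\mathcal G$ be the set of bijections $g:I\to I$ such that $g$ and $g^{-1}$ are Borel measurable and preserve $\lambda_0$. Let $H:V\times V\to\mathbb R$ satisfy - (H1) $H(x+z,p)=H(x,p)$ for all $x,p\in V$, $z\in\Lambda$; - (H2) $H(x\circ g,p\circ g)=H(x,p)$ for all $x,p\in V$, $g\in\mathcal G$; - (H3) $H$ is Lipschitz on $V\times B(0,R)$ for every $R>0$; - (H4) $\lim_{\|p\|\to\infty}\inf_{x\in V}H(x,p)=+\infty$; and let $u_0:V\to\mathbb R$ satisfy - (I1) $u_0(x)=u_0(Mx)$ for all $x\in V$, where $Mx\in V$ is the constant function with value $\int_I x\,d\lambda_0$; - (I2) $u_0\in C^1_b(V)$, i.e. $u_0$ is continuously Fréchet differentiable, and $u_0$ and $Du_0$ are bounded. For $\varepsilon>0$ consider the Cauchy problem $$u^\varepsilon_t+H\!\left(\tfrac{x}{\varepsilon},Du^\varepsilon\right)=0\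 \text{ in }V\times(0,\infty),\qquad u^\varepsilon(x,0)=u_0(x)\ \text{ on }V,\tag{CP$_\varepsilon$}$$ where $Du^\varepsilon\in V^*\cong V$. A solution is a continuous function $u^\varepsilon:V\times[0,\infty)\to\mathbb R$ with these initial values which satisfies the equation in the viscosity sense (with $C^1$ test functions) and has at most linear growth in $x$ locally uniformly in time: for every $T>0$ there is $K$ with $|u^\varepsilon(x,t)|\le K(1+\|x\|)$ for all $x\in V$, $0\le t\le T$. Then there is a constant $C>0$, independent of $\varepsilon$, such that for every $\varepsilon>0$ every solution $u^\varepsilon$ of (CP$_\varepsilon$) satisfies $$|u^\varepsilon(x,t)-u^\varepsilon(y,s)|\le C\,(\|x-y\|+|t-s|)\qquad\text{for all }x,y\in V,\ s,t\ge 0.$$ In particular each $u^\varepsilon$ is Lipschitz continuous in space and time. -/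

import Mathlib

open MeasureTheory Set

/-- The label set `I = [0,1]^d`, carrying Lebesgue measure `volume` (a probability measure). -/
abbrev Label (d : ℕ) : Type := Fin d → unitInterval

/-- The configuration space `V = L²(I; ℝ^d)`, with `ℝ^d` Euclidean. -/
abbrev ConfigSpace (d : ℕ) : Type :=
  Lp (EuclideanSpace ℝ (Fin d)) 2 (volume : Measure (Label d))

/-- The lattice `Λ = L²(I; ℤ^d)`, as a subset of `V`. -/
def latticeSet (d : ℕ) : Set (ConfigSpace d) :=
  {z | ∀ᵐ i : Label d, ∀ k : Fin d, ∃ n : ℤ, z i k = (n : ℝ)}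

/-- `(H1)`: `H(x + z, p) = H(x, p)` for all `z ∈ Λ`. -/
def IsLatticePeriodic {d : ℕ} (H : ConfigSpace d → ConfigSpace d → ℝ) : Prop :=
  ∀ x p z : ConfigSpace d, z ∈ latticeSet d → H (x + z) p = H x p

/-- `(H2)`: `H(x ∘ g, p ∘ g) = H(x, p)` for every Borel bijection `g : I → I` with Borel inverse
that preserves Lebesgue measure (then `g⁻¹` preserves it as well). -/
def IsRearrangementInvariant {d : ℕ} (H : ConfigSpace d → ConfigSpace d → ℝ) : Prop :=
  ∀ (g : Label d ≃ᵐ Label d) (hg : MeasurePreserving g volume volume) (x p : ConfigSpace d),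
    H (Lp.compMeasurePreserving g hg x) (Lp.compMeasurePreserving g hg p) = H x p

/-- `(H3)`: `H` is Lipschitz on `V × B(0,R)` for every `R > 0`. -/
def IsLipschitzOnBoundedMomenta {d : ℕ} (H : ConfigSpace d → ConfigSpace d → ℝ) : Prop :=
  ∀ R : ℝ, 0 < R → ∃ L : NNReal,
    LipschitzOnWith L (fun q : ConfigSpace d × ConfigSpace d => H q.1 q.2)
      (univ ×ˢ Metric.ball (0 : ConfigSpace d) R)

/-- `(H4)`: `inf_x H(x,p) → +∞` as `‖p‖ → ∞`, i.e. for every `M` one has `H(x,p) ≥ M` for all `x`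
as soon as `‖p‖` is large enough. -/
def IsCoerciveHamiltonian {d : ℕ} (H : ConfigSpace d → ConfigSpace d → ℝ) : Prop :=
  ∀ M : ℝ, ∃ R : ℝ, ∀ p : ConfigSpace d, R ≤ ‖p‖ → ∀ x : ConfigSpace d, M ≤ H x p

/-- `Mx = (∫_I x dλ₀) χ_I`, the constant configuration equal to the mean of `x`. -/
noncomputable def meanConfig {d : ℕ} (x : ConfigSpace d) : ConfigSpace d :=
  Lp.const 2 (volume : Measure (Label d)) (∫ i, x i)

/-- `(I1)`: `u₀` depends only on the mean configuration. -/
def DependsOnMean {d : ℕ} (u₀ : ConfigSpace d → ℝ) : Prop :=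
  ∀ x : ConfigSpace d, u₀ x = u₀ (meanConfig x)

/-- `(I2)`: `u₀ ∈ C_b^1(V)`, i.e. `u₀` is continuously Fréchet differentiable, and `u₀` and its
derivative are bounded. -/
def IsCb1 {d : ℕ} (u₀ : ConfigSpace d → ℝ) : Prop :=
  ContDiff ℝ 1 u₀ ∧ (∃ B : ℝ, ∀ x, |u₀ x| ≤ B) ∧ ∃ B : ℝ, ∀ x, ‖fderiv ℝ u₀ x‖ ≤ B

/-- `u` satisfies `u_t + F(x, Du) ≤ 0` in `V × (0,∞)` in the viscosity sense: the inequality holds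
for every `C¹` test function `φ` at every point of `V × (0,∞)` where `u - φ` has a local maximum.
The derivative `Dφ` in `x` is identified with an element of `V` by the Riesz theorem. -/
def IsViscositySubsolution {d : ℕ} (F : ConfigSpace d → ConfigSpace d → ℝ)
    (u : ConfigSpace d → ℝ → ℝ) : Prop :=
  ∀ φ : ConfigSpace d × ℝ → ℝ, ContDiffOn ℝ 1 φ (univ ×ˢ Ioi 0) →
    ∀ (x₀ : ConfigSpace d) (t₀ : ℝ), 0 < t₀ →
      IsLocalMax (fun q : ConfigSpace d × ℝ => u q.1 q.2 - φ q) (x₀, t₀) →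
        deriv (fun t => φ (x₀, t)) t₀ + F x₀ (gradient (fun x => φ (x, t₀)) x₀) ≤ 0

/-- `u` satisfies `u_t + F(x, Du) ≥ 0` in `V × (0,∞)` in the viscosity sense. -/
def IsViscositySupersolution {d : ℕ} (F : ConfigSpace d → ConfigSpace d → ℝ)
    (u : ConfigSpace d → ℝ → ℝ) : Prop :=
  ∀ φ : ConfigSpace d × ℝ → ℝ, ContDiffOn ℝ 1 φ (univ ×ˢ Ioi 0) →
    ∀ (x₀ : ConfigSpace d) (t₀ : ℝ), 0 < t₀ →
      IsLocalMin (fun q : ConfigSpace d × ℝ => u q.1 q.2 - φ q) (x₀, t₀) →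
        0 ≤ deriv (fun t => φ (x₀, t)) t₀ + F x₀ (gradient (fun x => φ (x, t₀)) x₀)

/-- `u` is a continuous viscosity solution on `V × [0,∞)` of the Cauchy problem
`u_t + F(x, Du) = 0` in `V × (0,∞)`, `u(·,0) = u₀`. Values `u x t` with `t < 0` play no role. -/
structure IsViscositySolution {d : ℕ} (F : ConfigSpace d → ConfigSpace d → ℝ)
    (u₀ : ConfigSpace d → ℝ) (u : ConfigSpace d → ℝ → ℝ) : Prop where
  continuousOn : ContinuousOn (fun q : ConfigSpace d × ℝ => u q.1 q.2) (univ ×ˢ Ici 0)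
  initial : ∀ x, u x 0 = u₀ x
  sub : IsViscositySubsolution F u
  super : IsViscositySupersolution F u

/-- At most linear growth in `x`, locally uniformly in `t ∈ [0,∞)`: the class in which the solution
of the Cauchy problem is understood to be unique. It contains all functions that are bounded, or
uniformly continuous, on `V × [0,T]` for every `T`. -/
def HasLinearGrowth {d : ℕ} (u : ConfigSpace d → ℝ → ℝ) : Prop :=
  ∀ T : ℝ, ∃ K : ℝ, ∀ (x : ConfigSpace d) (t : ℝ), 0 ≤ t → t ≤ T → |u x t| ≤ K * (1 + ‖x‖)

/-! ### Attained maxima in Hilbert space. -/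

section VariationalPrinciple

open Filter Topology

/-! Uniformity in ε rests on two facts that the rescaling x ↦ x/ε does not affect. Coordinatewise
fractional parts bring every configuration into a fixed ball modulo the lattice, so (H1) and (H3)
give |H| ≤ M for ‖p‖ ≤ B + 1, where B bounds ‖Du₀‖; and coercivity is uniform in x.

Hence u₀ ± Mt are barriers and |u − u₀| ≤ Mt (`IsViscositySolution.abs_sub_initial_le`). Now double
the variables within one solution (`IsViscositySolution.sub_le`). If u(x,t) − u(y,s) exceeded M|t−s|
+ R‖x−y‖ somewhere, the time slope at a penalized maximum would be at least about −M, so the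
equation forces H < M + 1 there and coercivity keeps the momentum well below R. That momentum is
essentially the slope of a smoothed cone of slope R, so the two space points nearly coincide, and
subtracting the two viscosity inequalities gives a contradiction. The Lipschitz constant of H(x/ε,
p) in x, which may grow like 1/ε, only decides how finely the cone is smoothed and never enters C.

Since V is in general not locally compact, maxima need not be attained; `exists_max_sub_normSq`
repairs this by subtracting one square whose gradient at the maximum is small. -/

/-- A function bounded above has approximate maximizers after subtracting a nonnegative penalty. -/
theorem exists_approx_max_sub {α : Type*} {S : Set α} {f P : α → ℝ} {C δ : ℝ}
    (hne : S.Nonempty) (hC : ∀ x ∈ S, f x ≤ C) (hP : ∀ x, 0 ≤ P x) (hδ : 0 < δ) :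
    ∃ x ∈ S, ∀ z ∈ S, f z - P z ≤ f x - P x + δ := by
  have hb : BddAbove ((fun x => f x - P x) '' S) :=
    ⟨C, by rintro _ ⟨x, hx, rfl⟩; have := hC x hx; have := hP x; dsimp only; linarith⟩
  obtain ⟨_, ⟨x, hx, rfl⟩, hlt⟩ := exists_lt_of_lt_csSup (hne.image _)
    (sub_lt_self (sSup ((fun x => f x - P x) '' S)) hδ)
  refine ⟨x, hx, fun z hz => ?_⟩
  have := le_csSup hb ⟨z, hz, rfl⟩
  dsimp only at this hlt
  linarith

variable {E : Type*} [NormedAddCommGroup E] [InnerProductSpace ℝ E]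

/-- A smooth variational principle of Borwein–Preiss type in Hilbert space: after subtracting a
single square, centred near the maximum point, a function bounded above attains its maximum. -/
theorem exists_max_sub_normSq [CompleteSpace E] {S : Set E} (hS : IsClosed S) {f : E → ℝ}
    (hf : ContinuousOn f S) {C : ℝ} (hC : ∀ x ∈ S, f x ≤ C) {x₁ : E} (hx₁ : x₁ ∈ S)
    {η : ℝ} (hη : 0 < η) :
    ∃ x ∈ S, ∃ c : E, ‖x - c‖ ≤ η ∧ f x₁ - η ≤ f x ∧
      ∀ z ∈ S, f z - ‖z - c‖ ^ 2 ≤ f x - ‖x - c‖ ^ 2 := by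
  have hpick : ∀ (P : E → ℝ) (δ : ℝ), ∃ x, x ∈ S ∧ ((∀ y, 0 ≤ P y) → 0 < δ →
      ∀ z ∈ S, f z - P z ≤ f x - P x + δ) := by
    intro P δ
    by_cases h : (∀ y, 0 ≤ P y) ∧ 0 < δ
    · obtain ⟨x, hx, hz⟩ := exists_approx_max_sub ⟨x₁, hx₁⟩ hC h.1 h.2
      exact ⟨x, hx, fun _ _ => hz⟩
    · exact ⟨x₁, hx₁, fun h1 h2 => absurd ⟨h1, h2⟩ h⟩
  choose N hNS hN using hpick
  -- The final loss in f is at most δ 0 + (8κ)² = 65κ², and κ ≤ 1.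
  obtain ⟨κ, hκ, hκ1, hκη⟩ : ∃ κ : ℝ, 0 < κ ∧ κ ≤ 1 ∧ 65 * κ ≤ η :=
    ⟨min 1 (η / 65), by positivity, min_le_left _ _, by
      have := min_le_right 1 (η / 65); linarith⟩
  -- The weights sum to 1, and δ n / w n decays like 4⁻ⁿ, which makes the approximate maximizers a
  -- geometric Cauchy sequence.
  let δ : ℕ → ℝ := fun n => κ ^ 2 * (1 / 8) ^ n
  let w : ℕ → ℝ := fun n => (1 / 2) ^ (n + 1)
  have hδ : ∀ n, 0 < δ n := fun n => by positivity
  have hw : ∀ n, 0 < w n := fun n => by positivity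
  let P : ℕ → E → ℝ := fun n => Nat.rec (fun _ => 0)
    (fun n Q x => Q x + w n * ‖x - N Q (δ n)‖ ^ 2) n
  let x : ℕ → E := fun n => N (P n) (δ n)
  have hP0 : ∀ y, P 0 y = 0 := fun _ => rfl
  have hPs : ∀ n y, P (n + 1) y = P n y + w n * ‖y - x n‖ ^ 2 := fun _ _ => rfl
  have hPn : ∀ n y, 0 ≤ P n y := by
    intro n
    induction n with
    | zero => intro y; exact (hP0 y).ge
    | succ n ih => intro y; rw [hPs]; have := ih y; have := hw n; positivity
  have hxS : ∀ n, x n ∈ S := fun n => hNS _ _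
  have hx : ∀ n, ∀ z ∈ S, f z - P n z ≤ f (x n) - P n (x n) + δ n :=
    fun n => hN _ _ (hPn n) (hδ n)
  clear_value P x
  have hstep : ∀ n, dist (x n) (x (n + 1)) ≤ 4 * κ / 2 / 2 ^ n := by
    intro n
    have h1 := hx n _ (hxS (n + 1))
    have h2 := hx (n + 1) _ (hxS n)
    rw [hPs, hPs, sub_self, norm_zero] at h2
    have h3 : w n * ‖x (n + 1) - x n‖ ^ 2 ≤ δ n + δ (n + 1) := by linarith
    have h4 : δ n + δ (n + 1) ≤ w n * (4 * κ / 2 / 2 ^ n) ^ 2 := by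
      have : w n * (4 * κ / 2 / 2 ^ n) ^ 2 = 2 * δ n := by
        simp only [w, δ, pow_succ, one_div, inv_pow]
        rw [show (8 : ℝ) = 2 * 2 * 2 by norm_num, mul_pow, mul_pow]
        field_simp
        ring
      have h5 : δ (n + 1) = δ n / 8 := by simp only [δ, pow_succ]; ring
      rw [this, h5]
      linarith [hδ n]
    rw [dist_comm, dist_eq_norm]
    exact le_of_sq_le_sq (le_of_mul_le_mul_left (h3.trans h4) (hw n)) (by positivity)
  obtain ⟨a, ha⟩ := cauchySeq_tendsto_of_complete (cauchySeq_of_le_geometric_two hstep)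
  have hxa : ∀ n, ‖x n - a‖ ≤ 4 * κ := fun n => by
    rw [← dist_eq_norm]
    refine (dist_le_of_le_geometric_two_of_tendsto hstep ha n).trans ?_
    exact div_le_self (by positivity) (one_le_pow₀ (by norm_num))
  have haS : a ∈ S := hS.mem_of_tendsto ha (Eventually.of_forall hxS)
  have hwsum : HasSum w 1 := by
    have := hasSum_geometric_two' (1 : ℝ)
    convert this using 2 with n
    simp only [w, pow_succ, one_div, inv_pow]
    field_simp
  have hdsum : Summable fun n => w n • (x n - a) := by
    refine Summable.of_norm_bounded (hwsum.summable.mul_right (4 * κ)) fun n => ?_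
    rw [norm_smul, Real.norm_of_nonneg (hw n).le]
    exact mul_le_mul_of_nonneg_left (hxa n) (hw n).le
  set v := ∑' n, w n • (x n - a) with hv
  have hvn : ‖v‖ ≤ 4 * κ := by
    have := tsum_of_norm_bounded (hwsum.mul_right (4 * κ)) (f := fun n => w n • (x n - a))
      fun n => by
        rw [norm_smul, Real.norm_of_nonneg (hw n).le]
        exact mul_le_mul_of_nonneg_left (hxa n) (hw n).le
    simpa using this
  -- Up to an additive constant a weighted sum of squares is one square plus a linear term. Since
  -- the total weight tends to 1, the limit penalty is ‖· − (a + v)‖² up to a constant.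
  have hPeq : ∀ n y z, P n y - P n z = (∑ k ∈ Finset.range n, w k) * (‖y - a‖ ^ 2 - ‖z - a‖ ^ 2)
      - 2 * inner ℝ (y - z) (∑ k ∈ Finset.range n, w k • (x k - a)) := by
    intro n y z
    induction n with
    | zero => simp [hP0]
    | succ n ih =>
      have e : ∀ y, ‖y - x n‖ ^ 2 = ‖y - a‖ ^ 2 - 2 * inner ℝ (y - a) (x n - a)
          + ‖x n - a‖ ^ 2 := fun y => by
        rw [← norm_sub_sq_real]; congr 2; abel
      have e2 : inner ℝ (y - z) (x n - a) = inner ℝ (y - a) (x n - a) - inner ℝ (z - a) (x n - a) := by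
        rw [← inner_sub_left]; congr 1; abel
      rw [hPs, hPs, Finset.sum_range_succ, Finset.sum_range_succ, inner_add_right,
        real_inner_smul_right, e, e, e2]
      linear_combination ih
  have hmax : ∀ z ∈ S, f z - ‖z - (a + v)‖ ^ 2 ≤ f a - ‖a - (a + v)‖ ^ 2 := by
    intro z hz
    have hlim : Tendsto (fun n => f (x n) - (P n (x n) - P n z) + δ n) atTop
        (𝓝 (f a - (1 * (‖a - a‖ ^ 2 - ‖z - a‖ ^ 2) - 2 * inner ℝ (a - z) v) + 0)) := by
      simp only [hPeq]
      have hfa : Tendsto (fun n => f (x n)) atTop (𝓝 (f a)) :=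
        (hf a haS).tendsto.comp
          (tendsto_nhdsWithin_iff.2 ⟨ha, Eventually.of_forall hxS⟩)
      have hδ0 : Tendsto δ atTop (𝓝 0) := by
        have := (tendsto_pow_atTop_nhds_zero_of_lt_one (r := (1 / 8 : ℝ)) (by norm_num)
          (by norm_num)).const_mul (κ ^ 2)
        simpa [δ] using this
      refine (hfa.sub ((hwsum.tendsto_sum_nat.mul ((((ha.sub_const a).norm.pow 2)).sub_const _)).sub
        (((ha.sub_const z).inner hdsum.hasSum.tendsto_sum_nat).const_mul 2))).add hδ0
    have hle : f z ≤ _ := ge_of_tendsto' hlim fun n => by linarith [hx n z hz]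
    have e : ‖z - (a + v)‖ ^ 2 = ‖z - a‖ ^ 2 - 2 * inner ℝ (z - a) v + ‖v‖ ^ 2 := by
      rw [← norm_sub_sq_real]; congr 2; abel
    have e2 : inner ℝ (a - z) v = - inner ℝ (z - a) v := by
      rw [← inner_neg_left, neg_sub]
    rw [e2, sub_self, norm_zero] at hle
    rw [e, show a - (a + v) = -v by abel, norm_neg]
    linarith
  refine ⟨a, haS, a + v, ?_, ?_, hmax⟩
  · rw [show a - (a + v) = -v by abel, norm_neg]; linarith
  · have h0 := hmax _ (hxS 0)
    have h1 := hx 0 _ hx₁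
    rw [hP0, hP0] at h1
    have h2 : ‖x 0 - (a + v)‖ ≤ 8 * κ := by
      rw [show x 0 - (a + v) = (x 0 - a) - v by abel]
      exact (norm_sub_le _ _).trans (by linarith [hxa 0])
    have h3 : ‖x 0 - (a + v)‖ ^ 2 ≤ (8 * κ) ^ 2 := by gcongr
    have h4 : δ 0 = κ ^ 2 := by simp [δ]
    nlinarith [sq_nonneg ‖a - (a + v)‖]

end VariationalPrinciple

/-! ### Calculus of test functions: squares and smoothed norms. -/

section Gradients

variable {E : Type*} [NormedAddCommGroup E] [InnerProductSpace ℝ E] [CompleteSpace E]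

theorem HasGradientAt.add' {f g : E → ℝ} {p q x : E} (hf : HasGradientAt f p x)
    (hg : HasGradientAt g q x) : HasGradientAt (fun y => f y + g y) (p + q) x := by
  rw [hasGradientAt_iff_hasFDerivAt] at *
  rw [map_add]
  exact hf.add hg

theorem HasGradientAt.const_mul' {f : E → ℝ} {p x : E} (k : ℝ) (hf : HasGradientAt f p x) :
    HasGradientAt (fun y => k * f y) (k • p) x := by
  rw [hasGradientAt_iff_hasFDerivAt] at *
  rw [map_smulₛₗ]
  exact hf.const_mul k

theorem hasGradientAt_normSq_sub (c x : E) :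
    HasGradientAt (fun y => ‖y - c‖ ^ 2) ((2 : ℝ) • (x - c)) x := by
  rw [hasGradientAt_iff_hasFDerivAt]
  refine ((hasFDerivAt_id x).sub_const c).norm_sq.congr_fderiv ?_
  ext y
  simp [InnerProductSpace.toDual_apply_apply]

/-- A C¹ substitute for the norm, which is not differentiable at its apex; it serves both to absorb
linear growth and as the cone in the doubling argument. -/
theorem hasGradientAt_sqrt_normSq_sub {κ : ℝ} (hκ : 0 < κ) (c x : E) :
    HasGradientAt (fun y => √(κ ^ 2 + ‖y - c‖ ^ 2))
      ((√(κ ^ 2 + ‖x - c‖ ^ 2))⁻¹ • (x - c)) x := by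
  have h := hasGradientAt_normSq_sub c x
  rw [hasGradientAt_iff_hasFDerivAt] at *
  refine ((h.const_add (κ ^ 2)).sqrt (by positivity)).congr_fderiv ?_
  rw [map_smulₛₗ, map_smulₛₗ, smul_smul]
  congr 1
  simp

end Gradients

section SmoothedNorm

variable {E : Type*} [NormedAddCommGroup E] [InnerProductSpace ℝ E]

theorem contDiff_normSq_sub (c : E) : ContDiff ℝ 1 fun y : E => ‖y - c‖ ^ 2 :=
  (contDiff_id.sub contDiff_const).norm_sq ℝ

theorem contDiff_sqrt_normSq_sub {κ : ℝ} (hκ : 0 < κ) (c : E) :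
    ContDiff ℝ 1 fun y : E => √(κ ^ 2 + ‖y - c‖ ^ 2) :=
  (contDiff_const.add (contDiff_normSq_sub c)).sqrt fun _ => by positivity

theorem norm_smul_inv_sqrt_le {κ : ℝ} (hκ : 0 < κ) (v : E) :
    ‖(√(κ ^ 2 + ‖v‖ ^ 2))⁻¹ • v‖ ≤ 1 := by
  rw [norm_smul, norm_inv, Real.norm_of_nonneg (Real.sqrt_nonneg _), inv_mul_le_one₀ (by positivity)]
  exact Real.le_sqrt_of_sq_le (by nlinarith)

theorem sqrt_sq_add_sq_le {κ a : ℝ} (hκ : 0 ≤ κ) (ha : 0 ≤ a) : √(κ ^ 2 + a ^ 2) ≤ κ + a :=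
  Real.sqrt_le_iff.2 ⟨by positivity, by nlinarith [mul_nonneg hκ ha]⟩

theorem le_sqrt_sq_add_sq (κ a : ℝ) : a ≤ √(κ ^ 2 + a ^ 2) :=
  Real.le_sqrt_of_sq_le (by nlinarith [sq_nonneg κ])

end SmoothedNorm

/-! ### The variational principle on space-time and on its square. -/

section VariationalPrincipleProd

variable {E : Type*} [NormedAddCommGroup E] [InnerProductSpace ℝ E] [CompleteSpace E]

/-- The product carries the sup norm, so the Hilbert principle is applied on `WithLp 2`, where the
square splits into separate space and time penalties. -/
theorem exists_max_sub_sq_prod {S : Set (E × ℝ)} (hS : IsClosed S) {f : E × ℝ → ℝ}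
    (hf : ContinuousOn f S) {C : ℝ} (hC : ∀ q ∈ S, f q ≤ C) {q₁ : E × ℝ} (hq₁ : q₁ ∈ S)
    {η : ℝ} (hη : 0 < η) :
    ∃ q ∈ S, ∃ c : E × ℝ, ‖q.1 - c.1‖ ≤ η ∧ |q.2 - c.2| ≤ η ∧ f q₁ - η ≤ f q ∧
      ∀ z ∈ S, f z - (‖z.1 - c.1‖ ^ 2 + (z.2 - c.2) ^ 2) ≤
        f q - (‖q.1 - c.1‖ ^ 2 + (q.2 - c.2) ^ 2) := by
  have hcont : Continuous (WithLp.ofLp : WithLp 2 (E × ℝ) → E × ℝ) :=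
    WithLp.prod_continuous_ofLp 2 E ℝ
  obtain ⟨x, hx, c, hxc, hfx, hmax⟩ := exists_max_sub_normSq (E := WithLp 2 (E × ℝ))
    (hS.preimage hcont) (f := fun q => f q.ofLp)
    (hf.comp hcont.continuousOn (mapsTo_preimage _ _)) (fun q hq => hC _ hq)
    (x₁ := WithLp.toLp 2 q₁) hq₁ hη
  have hn : ∀ z : WithLp 2 (E × ℝ), ‖z - c‖ ^ 2 =
      ‖z.ofLp.1 - c.ofLp.1‖ ^ 2 + (z.ofLp.2 - c.ofLp.2) ^ 2 := fun z => by
    rw [WithLp.prod_norm_sq_eq_of_L2, ← sq_abs (z.ofLp.2 - c.ofLp.2), ← Real.norm_eq_abs]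
    rfl
  refine ⟨x.ofLp, hx, c.ofLp, ?_, ?_, hfx, fun z hz => ?_⟩
  · refine (pow_le_pow_iff_left₀ (norm_nonneg _) (norm_nonneg _) two_ne_zero).1 ?_ |>.trans hxc
    rw [hn]; nlinarith [sq_nonneg (x.ofLp.2 - c.ofLp.2)]
  · refine (pow_le_pow_iff_left₀ (abs_nonneg _) (norm_nonneg _) two_ne_zero).1 ?_ |>.trans hxc
    rw [hn, sq_abs]; nlinarith [sq_nonneg ‖x.ofLp.1 - c.ofLp.1‖]
  · have := hmax (WithLp.toLp 2 z) hz
    rw [hn, hn] at this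
    exact this

theorem exists_max_sub_sq_prod_prod {S : Set ((E × ℝ) × (E × ℝ))} (hS : IsClosed S)
    {f : (E × ℝ) × (E × ℝ) → ℝ} (hf : ContinuousOn f S) {C : ℝ} (hC : ∀ q ∈ S, f q ≤ C)
    {q₁ : (E × ℝ) × (E × ℝ)} (hq₁ : q₁ ∈ S) {η : ℝ} (hη : 0 < η) :
    ∃ q ∈ S, ∃ c : (E × ℝ) × (E × ℝ), ‖q.1.1 - c.1.1‖ ≤ η ∧ |q.1.2 - c.1.2| ≤ η ∧
      ‖q.2.1 - c.2.1‖ ≤ η ∧ |q.2.2 - c.2.2| ≤ η ∧ f q₁ - η ≤ f q ∧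
      ∀ z ∈ S, f z - ((‖z.1.1 - c.1.1‖ ^ 2 + (z.1.2 - c.1.2) ^ 2)
          + (‖z.2.1 - c.2.1‖ ^ 2 + (z.2.2 - c.2.2) ^ 2)) ≤
        f q - ((‖q.1.1 - c.1.1‖ ^ 2 + (q.1.2 - c.1.2) ^ 2)
          + (‖q.2.1 - c.2.1‖ ^ 2 + (q.2.2 - c.2.2) ^ 2)) := by
  let W := WithLp 2 (WithLp 2 (E × ℝ) × WithLp 2 (E × ℝ))
  let π : W → (E × ℝ) × (E × ℝ) := fun w => (w.ofLp.1.ofLp, w.ofLp.2.ofLp)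
  have hcont : Continuous π := by
    have h1 := WithLp.prod_continuous_ofLp 2 E ℝ
    have h2 := WithLp.prod_continuous_ofLp 2 (WithLp 2 (E × ℝ)) (WithLp 2 (E × ℝ))
    exact (h1.comp (continuous_fst.comp h2)).prodMk (h1.comp (continuous_snd.comp h2))
  let ι : (E × ℝ) × (E × ℝ) → W := fun q => WithLp.toLp 2 (WithLp.toLp 2 q.1, WithLp.toLp 2 q.2)
  obtain ⟨x, hx, c, hxc, hfx, hmax⟩ := exists_max_sub_normSq (E := W)
    (hS.preimage hcont) (f := fun q => f (π q))
    (hf.comp hcont.continuousOn (mapsTo_preimage _ _)) (fun q hq => hC _ hq)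
    (x₁ := ι q₁) hq₁ hη
  have hn : ∀ z : W, ‖z - c‖ ^ 2 =
      (‖(π z).1.1 - (π c).1.1‖ ^ 2 + ((π z).1.2 - (π c).1.2) ^ 2) +
      (‖(π z).2.1 - (π c).2.1‖ ^ 2 + ((π z).2.2 - (π c).2.2) ^ 2) := fun z => by
    rw [WithLp.prod_norm_sq_eq_of_L2, WithLp.prod_norm_sq_eq_of_L2, WithLp.prod_norm_sq_eq_of_L2,
      ← sq_abs ((π z).1.2 - (π c).1.2), ← sq_abs ((π z).2.2 - (π c).2.2), ← Real.norm_eq_abs,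
      ← Real.norm_eq_abs]
    rfl
  have hle : ∀ b : ℝ, 0 ≤ b → b ^ 2 ≤ ‖x - c‖ ^ 2 → b ≤ η := fun b hb h =>
    ((pow_le_pow_iff_left₀ hb (norm_nonneg _) two_ne_zero).1 h).trans hxc
  have s1 := sq_nonneg ‖(π x).1.1 - (π c).1.1‖
  have s2 := sq_nonneg ((π x).1.2 - (π c).1.2)
  have s3 := sq_nonneg ‖(π x).2.1 - (π c).2.1‖
  have s4 := sq_nonneg ((π x).2.2 - (π c).2.2)
  refine ⟨π x, hx, π c, hle _ (norm_nonneg _) ?_, hle _ (abs_nonneg _) ?_,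
    hle _ (norm_nonneg _) ?_, hle _ (abs_nonneg _) ?_, hfx, fun z hz => ?_⟩
  · rw [hn]; linarith
  · rw [hn, sq_abs]; linarith
  · rw [hn]; linarith
  · rw [hn, sq_abs]; linarith
  · have := hmax (ι z) hz
    rw [hn, hn] at this
    exact this

end VariationalPrincipleProd

/-! ### Barriers for subsolutions. -/

section Viscosity

open Topology

variable {d : ℕ} {F : ConfigSpace d → ConfigSpace d → ℝ} {u : ConfigSpace d → ℝ → ℝ}
  {u₀ : ConfigSpace d → ℝ}

/-- The subsolution inequality for a separated test function `a x + b t`. -/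
theorem IsViscositySubsolution.le_zero (hu : IsViscositySubsolution F u)
    {a : ConfigSpace d → ℝ} {b : ℝ → ℝ} (ha : ContDiff ℝ 1 a) (hb : ContDiff ℝ 1 b)
    {x₀ p : ConfigSpace d} {t₀ β : ℝ} (hp : HasGradientAt a p x₀) (hβ : HasDerivAt b β t₀)
    (ht₀ : 0 < t₀)
    (hmax : IsLocalMax (fun q : ConfigSpace d × ℝ => u q.1 q.2 - (a q.1 + b q.2)) (x₀, t₀)) :
    β + F x₀ p ≤ 0 := by
  have h := hu (fun q => a q.1 + b q.2)
    ((ha.comp contDiff_fst).add (hb.comp contDiff_snd)).contDiffOn x₀ t₀ ht₀ hmax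
  have h1 : HasGradientAt (fun x => a x + b t₀) p x₀ := by
    rw [hasGradientAt_iff_hasFDerivAt] at *
    exact hp.add_const _
  rwa [h1.gradient, (hβ.const_add (a x₀)).deriv] at h

/-- If `u` is a supersolution for `F`, then `-u` is a subsolution for `-F(x, -p)`. -/
theorem IsViscositySupersolution.neg (hu : IsViscositySupersolution F u) :
    IsViscositySubsolution (fun x p => -F x (-p)) (fun x t => -u x t) := by
  intro φ hφ x₀ t₀ ht₀ hmax
  have hmin : IsLocalMin (fun q : ConfigSpace d × ℝ => u q.1 q.2 - (-φ q)) (x₀, t₀) := by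
    filter_upwards [hmax] with q hq
    linarith
  have h := hu (fun q => -φ q) hφ.neg x₀ t₀ ht₀ hmin
  have hg : gradient (fun x => -φ (x, t₀)) x₀ = -gradient (fun x => φ (x, t₀)) x₀ := by
    simp only [gradient]
    rw [fderiv_fun_neg, map_neg]
  rw [hg, deriv.fun_neg] at h
  linarith

/-- Comparison of a subsolution of linear growth with `u₀ x + M t`, where `-M` bounds the
Hamiltonian from below on the relevant momenta. -/
theorem IsViscositySubsolution.le_initial_add (hu : IsViscositySubsolution F u)
    (hcont : ContinuousOn (fun q : ConfigSpace d × ℝ => u q.1 q.2) (univ ×ˢ Ici 0))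
    (hinit : ∀ x, u x 0 = u₀ x) (hC1 : ContDiff ℝ 1 u₀) {B₀ B : ℝ} (hB₀ : ∀ x, |u₀ x| ≤ B₀)
    (hB : ∀ x, ‖fderiv ℝ u₀ x‖ ≤ B) {k M : ℝ} (hk : 0 ≤ k) (hM0 : 0 ≤ M)
    (hM : ∀ x p, ‖p‖ ≤ B + k + 1 → -M ≤ F x p) {T K : ℝ}
    (hg : ∀ x t, 0 ≤ t → t ≤ T + 1 → u x t ≤ K + k * ‖x‖) :
    ∀ x t, 0 ≤ t → t ≤ T → u x t ≤ u₀ x + M * t := by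
  intro x₁ t₁ ht₁ ht₁T
  by_contra! hlt
  obtain ⟨σ, hσ, hσeq⟩ : ∃ σ, 0 < σ ∧ 4 * σ = u x₁ t₁ - u₀ x₁ - M * t₁ :=
    ⟨(u x₁ t₁ - u₀ x₁ - M * t₁) / 4, by linarith, by ring⟩
  have hB₀0 : 0 ≤ B₀ := (abs_nonneg _).trans (hB₀ 0)
  -- The penalty has slope at most k and dominates k‖x‖ up to a constant; a large ρ flattens it near
  -- the origin, so that it costs at most σ at x₁.
  obtain ⟨ρ, hρ, hρσ⟩ : ∃ ρ : ℝ, 0 < ρ ∧ k * (√(ρ ^ 2 + ‖x₁ - 0‖ ^ 2) - ρ) ≤ σ := by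
    set a := ‖x₁ - 0‖ with ha
    refine ⟨k * a ^ 2 / (2 * σ) + 1, by positivity, ?_⟩
    set ρ := k * a ^ 2 / (2 * σ) + 1 with hρ
    have hρ0 : 0 < ρ := by positivity
    have h1 : √(ρ ^ 2 + a ^ 2) ≤ ρ + a ^ 2 / (2 * ρ) := by
      refine Real.sqrt_le_iff.2 ⟨by positivity, ?_⟩
      have : (ρ + a ^ 2 / (2 * ρ)) ^ 2 = ρ ^ 2 + a ^ 2 + (a ^ 2 / (2 * ρ)) ^ 2 := by
        field_simp; ring
      rw [this]; nlinarith [sq_nonneg (a ^ 2 / (2 * ρ))]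
    have h2 : k * (a ^ 2 / (2 * ρ)) ≤ σ := by
      rw [mul_div_assoc', div_le_iff₀ (by positivity)]
      have : k * a ^ 2 / (2 * σ) ≤ ρ := by linarith
      rw [div_le_iff₀ (by positivity)] at this
      linarith
    calc k * (√(ρ ^ 2 + a ^ 2) - ρ) ≤ k * (a ^ 2 / (2 * ρ)) := by
          gcongr; linarith
      _ ≤ σ := h2
  have hpen : ∀ x : ConfigSpace d, 0 ≤ k * (√(ρ ^ 2 + ‖x - 0‖ ^ 2) - ρ) := fun x =>
    mul_nonneg hk (sub_nonneg.2 (Real.le_sqrt_of_sq_le (by nlinarith [sq_nonneg ‖x - 0‖])))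
  have hpen' : ∀ x : ConfigSpace d, k * ‖x‖ - k * ρ ≤ k * (√(ρ ^ 2 + ‖x - 0‖ ^ 2) - ρ) := fun x => by
    have := mul_le_mul_of_nonneg_left (le_sqrt_sq_add_sq ρ ‖x - 0‖) hk
    rw [sub_zero] at *
    linarith
  -- The term g equals σ at t₁ but exceeds σN at T + 1, which keeps the maximum off the artificial
  -- final time; its derivative N g > 0 makes the barrier strict.
  obtain ⟨N, hN, hNeq⟩ : ∃ N, 0 < N ∧ K + k * ρ + B₀ ≤ σ * N := by
    refine ⟨(|K| + k * ρ + B₀) / σ + 1, by positivity, ?_⟩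
    rw [mul_add, mul_div_cancel₀ _ hσ.ne']
    linarith [le_abs_self K]
  set g : ℝ → ℝ := fun t => σ * Real.exp (N * (t - t₁)) with hgdef
  have hg0 : ∀ t, 0 < g t := fun t => by positivity
  have hgd : ∀ t, HasDerivAt g (N * g t) t := fun t => by
    have := ((((hasDerivAt_id t).sub_const t₁).const_mul N).exp).const_mul σ
    refine this.congr_deriv ?_
    simp [hgdef]; ring
  have hgC : ContDiff ℝ 1 g := by fun_prop
  set f : ConfigSpace d × ℝ → ℝ := fun q =>
    u q.1 q.2 - u₀ q.1 - M * q.2 - k * (√(ρ ^ 2 + ‖q.1 - 0‖ ^ 2) - ρ) - g q.2 with hf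
  have hfT : ∀ x t, 0 ≤ t → t ≤ T + 1 → f (x, t) ≤ K + k * ρ + B₀ - g t := fun x t h0 h1 => by
    have := hg x t h0 h1
    have := hpen' x
    have := (abs_le.1 (hB₀ x)).1
    have : 0 ≤ M * t := by positivity
    simp only [hf]
    linarith
  obtain ⟨η, hη, hη1, hησ, hηg⟩ : ∃ η : ℝ, 0 < η ∧ η ≤ 1 / 2 ∧ η ≤ σ ∧ 4 * η ≤ N * g 0 := by
    have : 0 < N * g 0 := mul_pos hN (hg0 0)
    refine ⟨min (1 / 2) (min σ (N * g 0 / 4)), by positivity, min_le_left _ _,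
      (min_le_right _ _).trans (min_le_left _ _), ?_⟩
    linarith [(min_le_right (1 / 2 : ℝ) (min σ (N * g 0 / 4))).trans (min_le_right _ _)]
  obtain ⟨⟨x, t⟩, ⟨-, ht0, htT⟩, ⟨c, τ⟩, hxc, htτ, hfx, hmax⟩ :=
    exists_max_sub_sq_prod (S := (univ : Set (ConfigSpace d)) ×ˢ Icc 0 (T + 1))
      (isClosed_univ.prod isClosed_Icc) (f := f)
      (by
        have h1 := hcont.mono (prod_mono_right (s := (univ : Set (ConfigSpace d)))
          (Icc_subset_Ici_self : Icc 0 (T + 1) ⊆ Ici 0))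
        have h2 := (contDiff_sqrt_normSq_sub hρ (0 : ConfigSpace d)).continuous
        have h3 := hC1.continuous
        have h4 := hgC.continuous
        have h5 : Continuous fun q : ConfigSpace d × ℝ =>
          u₀ q.1 + M * q.2 + k * (√(ρ ^ 2 + ‖q.1 - 0‖ ^ 2) - ρ) + g q.2 := by fun_prop
        refine (h1.sub h5.continuousOn).congr fun q _ => ?_
        simp only [hf, Pi.sub_apply]; ring)
      (C := K + k * ρ + B₀) (fun q hq => (hfT q.1 q.2 hq.2.1 hq.2.2).trans (by linarith [hg0 q.2]))
      (q₁ := (x₁, t₁)) ⟨mem_univ _, ht₁, by dsimp only; linarith⟩ hη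
  dsimp only at ht0 htT hxc htτ hmax
  have hf1 : 2 * σ ≤ f (x₁, t₁) := by
    have : g t₁ = σ := by simp [hgdef]
    simp only [hf]
    linarith
  have htpos : 0 < t := by
    rcases ht0.eq_or_lt with rfl | h
    · have : f (x, 0) ≤ 0 := by
        simp only [hf, hinit]
        linarith [hpen x, hg0 0]
      linarith
    · exact h
  have htlt : t < T + 1 := by
    rcases htT.eq_or_lt with h | h
    · have h1 := hfT x t ht0 htT
      have h2 : σ * N ≤ g t := by
        refine mul_le_mul_of_nonneg_left ?_ hσ.le
        have := Real.add_one_le_exp (N * (t - t₁))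
        have : N * 1 ≤ N * (t - t₁) := by gcongr; linarith
        linarith
      linarith
    · exact h
  have hnhds : (univ : Set (ConfigSpace d)) ×ˢ Icc 0 (T + 1) ∈ 𝓝 (x, t) :=
    prod_mem_nhds Filter.univ_mem (Icc_mem_nhds htpos htlt)
  have hgrad : HasGradientAt u₀ (gradient u₀ x) x :=
    (hC1.differentiable one_ne_zero x).hasGradientAt
  have hgradn : ‖gradient u₀ x‖ ≤ B := by
    have := hB x
    rwa [← toDual_gradient, LinearIsometryEquiv.norm_map] at this
  -- With F ≥ −M this yields N g(t) ≤ 2η, against 4η ≤ N g(0) ≤ N g(t).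
  have key := hu.le_zero (x₀ := x) (t₀ := t)
    (a := fun y => u₀ y + (k * √(ρ ^ 2 + ‖y - 0‖ ^ 2) + ‖y - c‖ ^ 2))
    (b := fun s => M * s + g s + (s - τ) ^ 2)
    (hC1.add ((contDiff_const.mul (contDiff_sqrt_normSq_sub hρ 0)).add (contDiff_normSq_sub c)))
    (by fun_prop)
    (hgrad.add' (((hasGradientAt_sqrt_normSq_sub hρ 0 x).const_mul' k).add'
      (hasGradientAt_normSq_sub c x)))
    ((((hasDerivAt_id t).const_mul M).add (hgd t)).add (((hasDerivAt_id t).sub_const τ).pow 2))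
    htpos
    (by
      filter_upwards [hnhds] with q hq
      have := hmax q hq
      simp only [hf] at this ⊢
      linarith)
  have hFM := hM x _ (show ‖gradient u₀ x + (k • (√(ρ ^ 2 + ‖x - 0‖ ^ 2))⁻¹ • (x - 0)
      + (2 : ℝ) • (x - c))‖ ≤ B + k + 1 by
    have h1 := norm_smul_inv_sqrt_le hρ (x - 0)
    have h2 : ‖k • (√(ρ ^ 2 + ‖x - 0‖ ^ 2))⁻¹ • (x - 0)‖ ≤ k := by
      rw [norm_smul, Real.norm_of_nonneg hk]
      exact mul_le_of_le_one_right hk h1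
    have h3 : ‖(2 : ℝ) • (x - c)‖ ≤ 1 := by
      rw [norm_smul, Real.norm_of_nonneg zero_le_two]; linarith
    calc _ ≤ ‖gradient u₀ x‖ + (‖k • (√(ρ ^ 2 + ‖x - 0‖ ^ 2))⁻¹ • (x - 0)‖
          + ‖(2 : ℝ) • (x - c)‖) := norm_add_le_of_le le_rfl (norm_add_le _ _)
      _ ≤ B + k + 1 := by linarith)
  have hgt : N * g 0 ≤ N * g t := by
    simp only [hgdef]; gcongr
  have := (abs_le.1 htτ).1
  have hpos : 0 < N * g 0 := mul_pos hN (hg0 0)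
  rw [sub_zero] at hFM
  simp at key
  linarith

end Viscosity

/-! ### Speed bound and doubling of variables. -/

section Lipschitz

open Topology

variable {d : ℕ} {F : ConfigSpace d → ConfigSpace d → ℝ} {u : ConfigSpace d → ℝ → ℝ}
  {u₀ : ConfigSpace d → ℝ}

/-- A subsolution of at most linear growth stays below `u₀ + M t`, with `M` depending only on the
Hamiltonian at momenta of size at most `sup ‖Du₀‖ + 1`. -/
theorem IsViscositySubsolution.le_initial_add_of_linearGrowth (hu : IsViscositySubsolution F u)
    (hcont : ContinuousOn (fun q : ConfigSpace d × ℝ => u q.1 q.2) (univ ×ˢ Ici 0))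
    (hinit : ∀ x, u x 0 = u₀ x) (hC1 : ContDiff ℝ 1 u₀) {B₀ B : ℝ} (hB₀ : ∀ x, |u₀ x| ≤ B₀)
    (hB : ∀ x, ‖fderiv ℝ u₀ x‖ ≤ B) (hbd : ∀ r, ∃ m, ∀ x p, ‖p‖ ≤ r → -m ≤ F x p)
    (hg : ∀ T : ℝ, ∃ K : ℝ, ∀ x t, 0 ≤ t → t ≤ T → u x t ≤ K * (1 + ‖x‖))
    {M : ℝ} (hM0 : 0 ≤ M) (hM : ∀ x p, ‖p‖ ≤ B + 1 → -M ≤ F x p) {x : ConfigSpace d} {t : ℝ}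
    (ht : 0 ≤ t) : u x t ≤ u₀ x + M * t := by
  obtain ⟨K, hK⟩ := hg (t + 1 + 1)
  obtain ⟨m, hm⟩ := hbd (B + |K| + 1)
  -- First pass: cancelling the growth costs slope |K|, so the speed |m| depends on u, but u becomes
  -- bounded above on [0, t + 1].
  have h1 := hu.le_initial_add hcont hinit hC1 hB₀ hB (k := |K|) (M := |m|) (T := t + 1) (K := |K|)
    (abs_nonneg K) (abs_nonneg m) (fun x p hp => (neg_le_neg (le_abs_self m)).trans (hm x p hp))
    (fun x s hs hsT => (hK x s hs hsT).trans (by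
      nlinarith [le_abs_self K, norm_nonneg x]))
  -- Second pass: boundedness allows k = 0, and the speed is M, independent of the growth.
  refine hu.le_initial_add hcont hinit hC1 hB₀ hB (k := 0) (T := t) (K := B₀ + |m| * (t + 1))
    le_rfl hM0 (fun x p hp => hM x p (by simpa using hp)) (fun x s hs hsT => ?_) x t ht le_rfl
  have h2 := h1 x s hs hsT
  have h3 := mul_le_mul_of_nonneg_left hsT (abs_nonneg m)
  have h4 := (abs_le.1 (hB₀ x)).2
  linarith

/-- A solution of at most linear growth departs from its initial datum at bounded speed. -/
theorem IsViscositySolution.abs_sub_initial_le (hu : IsViscositySolution F u₀ u)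
    (hg : HasLinearGrowth u) (hC1 : ContDiff ℝ 1 u₀) {B₀ B : ℝ} (hB₀ : ∀ x, |u₀ x| ≤ B₀)
    (hB : ∀ x, ‖fderiv ℝ u₀ x‖ ≤ B) (hbd : ∀ r, ∃ m, ∀ x p, ‖p‖ ≤ r → |F x p| ≤ m)
    {M : ℝ} (hM0 : 0 ≤ M) (hM : ∀ x p, ‖p‖ ≤ B + 1 → |F x p| ≤ M) {x : ConfigSpace d} {t : ℝ}
    (ht : 0 ≤ t) : |u x t - u₀ x| ≤ M * t := by
  have h1 := hu.sub.le_initial_add_of_linearGrowth hu.continuousOn hu.initial hC1 hB₀ hB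
    (fun r => (hbd r).imp fun m hm x p hp => (abs_le.1 (hm x p hp)).1)
    (fun T => (hg T).imp fun K hK x t h0 hT => (abs_le.1 (hK x t h0 hT)).2)
    hM0 (fun x p hp => (abs_le.1 (hM x p hp)).1) (x := x) ht
  have h2 := hu.super.neg.le_initial_add_of_linearGrowth (u₀ := fun x => -u₀ x)
    hu.continuousOn.neg (fun x => by rw [hu.initial]) hC1.neg
    (fun x => by rw [abs_neg]; exact hB₀ x)
    (fun x => by rw [fderiv_fun_neg, norm_neg]; exact hB x)
    (fun r => (hbd r).imp fun m hm x p hp =>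
      neg_le_neg (abs_le.1 (hm x (-p) (by rwa [norm_neg]))).2)
    (fun T => (hg T).imp fun K hK x t h0 hT => neg_le.1 (abs_le.1 (hK x t h0 hT)).1)
    hM0 (fun x p hp => neg_le_neg (abs_le.1 (hM x (-p) (by rwa [norm_neg]))).2) (x := x) ht
  rw [abs_le]
  constructor <;> linarith

theorem hasDerivAt_sqrt_sq_sub {κ : ℝ} (hκ : 0 < κ) (s t : ℝ) :
    HasDerivAt (fun r => √(κ ^ 2 + (r - s) ^ 2)) ((t - s) / √(κ ^ 2 + (t - s) ^ 2)) t := by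
  have h : HasDerivAt (fun r => κ ^ 2 + (r - s) ^ 2) (2 * (t - s)) t :=
    ((((hasDerivAt_id t).sub_const s).pow 2).const_add (κ ^ 2)).congr_deriv (by simp)
  exact (h.sqrt (by positivity)).congr_deriv (mul_div_mul_left _ _ two_ne_zero)

theorem contDiff_sqrt_sq_sub {κ : ℝ} (hκ : 0 < κ) (s : ℝ) :
    ContDiff ℝ 1 fun r : ℝ => √(κ ^ 2 + (r - s) ^ 2) :=
  ContDiff.sqrt (by fun_prop) fun _ => by positivity

theorem abs_div_sqrt_le_one (κ a : ℝ) : |a / √(κ ^ 2 + a ^ 2)| ≤ 1 := by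
  rw [abs_div, abs_of_nonneg (Real.sqrt_nonneg _)]
  exact div_le_one_of_le₀ (Real.abs_le_sqrt (by nlinarith [sq_nonneg κ])) (Real.sqrt_nonneg _)

/-- If the slope of a smoothed cone of slope `R ≥ r + 1` is at most `r` at a point, then this point
lies within `r κ` of the apex. -/
theorem norm_le_of_norm_smul_inv_sqrt_le {E : Type*} [NormedAddCommGroup E] [NormedSpace ℝ E]
    {κ r R : ℝ} (hκ : 0 < κ) (hr : 0 ≤ r) (hR : r + 1 ≤ R) {v : E}
    (h : ‖R • (√(κ ^ 2 + ‖v‖ ^ 2))⁻¹ • v‖ ≤ r) : ‖v‖ ≤ r * κ := by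
  have hS : 0 < √(κ ^ 2 + ‖v‖ ^ 2) := by positivity
  have hS2 : √(κ ^ 2 + ‖v‖ ^ 2) ^ 2 = κ ^ 2 + ‖v‖ ^ 2 := Real.sq_sqrt (by positivity)
  rw [norm_smul, norm_smul, norm_inv, Real.norm_of_nonneg hS.le, Real.norm_of_nonneg (by linarith),
    inv_mul_eq_div, mul_div_assoc', div_le_iff₀ hS] at h
  have h1 : (R * ‖v‖) ^ 2 ≤ (r * √(κ ^ 2 + ‖v‖ ^ 2)) ^ 2 :=
    pow_le_pow_left₀ (mul_nonneg (by linarith) (norm_nonneg v)) h 2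
  rw [mul_pow, mul_pow, hS2] at h1
  -- This gives R² − r² ≥ 1, hence ‖v‖² ≤ (R² − r²)‖v‖² ≤ r²κ².
  have h2 : (r + 1) ^ 2 ≤ R ^ 2 := pow_le_pow_left₀ (by linarith) hR 2
  refine le_of_sq_le_sq ?_ (by positivity)
  nlinarith [sq_nonneg ‖v‖, mul_le_mul_of_nonneg_right h2 (sq_nonneg ‖v‖), mul_nonneg hr (sq_nonneg ‖v‖)]

/-- Doubling of variables: coercivity bounds the momentum at the maximum point, so that a solution
departing from a Lipschitz datum at speed `M` is Lipschitz in space and time. -/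
theorem IsViscositySolution.sub_le (hu : IsViscositySolution F u₀ u) {B₀ B M R₀ R : ℝ}
    (hB₀ : ∀ x, |u₀ x| ≤ B₀) (hLip : ∀ x y, |u₀ x - u₀ y| ≤ B * ‖x - y‖) (hM0 : 0 ≤ M)
    (hM : ∀ x t, 0 ≤ t → |u x t - u₀ x| ≤ M * t) (hR₀ : 0 ≤ R₀)
    (hcoer : ∀ x p, R₀ ≤ ‖p‖ → M + 1 < F x p)
    (hF : ∀ r : ℝ, ∃ L : ℝ, 0 ≤ L ∧ ∀ x y p q, ‖p‖ < r → ‖q‖ < r →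
      |F x p - F y q| ≤ L * (‖x - y‖ + ‖p - q‖))
    (hBR : B ≤ R) (hR : R₀ + 2 ≤ R) {x y : ConfigSpace d} {t s : ℝ} (ht : 0 ≤ t) (hs : 0 ≤ s) :
    u x t - u y s ≤ M * |t - s| + R * ‖x - y‖ := by
  by_contra! hlt
  obtain ⟨σ, hσ, hσeq⟩ : ∃ σ, 0 < σ ∧ 4 * σ = u x t - u y s - M * |t - s| - R * ‖x - y‖ :=
    ⟨(u x t - u y s - M * |t - s| - R * ‖x - y‖) / 4, by linarith, by ring⟩
  have hR0 : 0 ≤ R := by linarith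
  -- In l(t + t²) the square bounds the functional above on the infinite time interval, and the
  -- linear part makes the inequality strict by l.
  obtain ⟨l, hl, hlσ⟩ : ∃ l, 0 < l ∧ l * (t + t ^ 2) ≤ σ := by
    refine ⟨σ / (1 + t + t ^ 2), by positivity, ?_⟩
    rw [div_mul_eq_mul_div, div_le_iff₀ (by positivity)]
    exact mul_le_mul_of_nonneg_left (by linarith) hσ.le
  obtain ⟨L, hL0, hL⟩ := hF (R₀ + 3)
  -- κ is chosen after L: the points will be within (R₀ + 1)κ, so their contribution to the
  -- difference of Hamiltonians is at most l/4.
  obtain ⟨κ, hκ, hκσ, hκl⟩ : ∃ κ, 0 < κ ∧ κ * (M + R) ≤ σ ∧ L * ((R₀ + 1) * κ) ≤ l / 4 := by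
    refine ⟨min (σ / (M + R + 1)) (l / 4 / (L * (R₀ + 1) + 1)), by positivity, ?_, ?_⟩
    · have := min_le_left (σ / (M + R + 1)) (l / 4 / (L * (R₀ + 1) + 1))
      have hpos : 0 < min (σ / (M + R + 1)) (l / 4 / (L * (R₀ + 1) + 1)) := by positivity
      rw [le_div_iff₀ (by positivity)] at this
      linarith
    · have := min_le_right (σ / (M + R + 1)) (l / 4 / (L * (R₀ + 1) + 1))
      have hpos : 0 < min (σ / (M + R + 1)) (l / 4 / (L * (R₀ + 1) + 1)) := by positivity
      rw [le_div_iff₀ (by positivity)] at this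
      linarith
  obtain ⟨η, hη, hη1, hησ, hηl⟩ : ∃ η : ℝ, 0 < η ∧ η ≤ 1 / 4 ∧ η ≤ σ ∧ η * (4 * (1 + L)) ≤ l / 4 := by
    refine ⟨min (1 / 4) (min σ (l / 4 / (4 * (1 + L)))), by positivity, min_le_left _ _,
      (min_le_right _ _).trans (min_le_left _ _), ?_⟩
    rw [← le_div_iff₀ (by positivity)]
    exact (min_le_right _ _).trans (min_le_right _ _)
  set f : (ConfigSpace d × ℝ) × (ConfigSpace d × ℝ) → ℝ := fun q =>
    u q.1.1 q.1.2 - u q.2.1 q.2.2 - (M * √(κ ^ 2 + (q.1.2 - q.2.2) ^ 2)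
      + R * √(κ ^ 2 + ‖q.1.1 - q.2.1‖ ^ 2) + l * (q.1.2 + q.1.2 ^ 2)) with hf
  have hfle : ∀ x t y s, 0 ≤ t → f ((x, t), (y, s)) ≤
      u x t - u y s - M * |t - s| - R * ‖x - y‖ - l * t ^ 2 := fun x t y s ht => by
    have h1 := mul_le_mul_of_nonneg_left (le_sqrt_sq_add_sq κ |t - s|) hM0
    have h2 := mul_le_mul_of_nonneg_left (le_sqrt_sq_add_sq κ ‖x - y‖) hR0
    rw [sq_abs] at h1
    have h3 : 0 ≤ l * t := by positivity
    simp only [hf]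
    linarith
  have hbound : ∀ q ∈ ((univ : Set (ConfigSpace d)) ×ˢ Ici (0 : ℝ)) ×ˢ
      ((univ : Set (ConfigSpace d)) ×ˢ Ici (0 : ℝ)), f q ≤ 2 * B₀ + M ^ 2 / l := by
    rintro ⟨⟨x, t⟩, ⟨y, s⟩⟩ ⟨⟨-, ht⟩, ⟨-, hs⟩⟩
    change 0 ≤ t at ht
    change 0 ≤ s at hs
    have h1 := (abs_le.1 (hM x t ht)).2
    have h2 := (abs_le.1 (hM y s hs)).1
    have h3 := (abs_le.1 (hB₀ x)).2
    have h4 := (abs_le.1 (hB₀ y)).1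
    have h5 : M * s ≤ M * (t + |t - s|) :=
      mul_le_mul_of_nonneg_left (by linarith [neg_abs_le (t - s)]) hM0
    have h6 : 2 * (M * t) - l * t ^ 2 ≤ M ^ 2 / l := by
      rw [le_div_iff₀ hl]; nlinarith [sq_nonneg (M - l * t)]
    have h7 : 0 ≤ R * ‖x - y‖ := by positivity
    linarith [hfle x t y s ht]
  have hfcont : ContinuousOn f (((univ : Set (ConfigSpace d)) ×ˢ Ici (0 : ℝ)) ×ˢ
      ((univ : Set (ConfigSpace d)) ×ˢ Ici (0 : ℝ))) := by
    have h1 := hu.continuousOn.comp continuousOn_fst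
      (fun (q : (ConfigSpace d × ℝ) × (ConfigSpace d × ℝ)) hq => (hq : q ∈
        ((univ : Set (ConfigSpace d)) ×ˢ Ici (0 : ℝ)) ×ˢ
        ((univ : Set (ConfigSpace d)) ×ˢ Ici (0 : ℝ))).1)
    have h2 := hu.continuousOn.comp continuousOn_snd
      (fun (q : (ConfigSpace d × ℝ) × (ConfigSpace d × ℝ)) hq => (hq : q ∈
        ((univ : Set (ConfigSpace d)) ×ˢ Ici (0 : ℝ)) ×ˢ
        ((univ : Set (ConfigSpace d)) ×ˢ Ici (0 : ℝ))).2)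
    exact (h1.sub h2).sub (Continuous.continuousOn (by fun_prop))
  obtain ⟨⟨⟨a, τ⟩, ⟨b, ω⟩⟩, ⟨⟨-, hτ⟩, ⟨-, hω⟩⟩, ⟨⟨c, τ'⟩, ⟨e, ω'⟩⟩, hac, hττ, hbe, hωω, hfη, hmax⟩ :=
    exists_max_sub_sq_prod_prod ((isClosed_univ.prod isClosed_Ici).prod
      (isClosed_univ.prod isClosed_Ici)) hfcont hbound (q₁ := ((x, t), (y, s)))
      ⟨⟨mem_univ _, ht⟩, ⟨mem_univ _, hs⟩⟩ hη
  change 0 ≤ τ at hτ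
  change 0 ≤ ω at hω
  dsimp only at hac hττ hbe hωω hmax
  have hfxy : 2 * σ ≤ f ((x, t), (y, s)) := by
    have h1 := mul_le_mul_of_nonneg_left (sqrt_sq_add_sq_le hκ.le (abs_nonneg (t - s))) hM0
    have h2 := mul_le_mul_of_nonneg_left (sqrt_sq_add_sq_le hκ.le (norm_nonneg (x - y))) hR0
    rw [sq_abs] at h1
    simp only [hf]
    linarith
  have hfpos : 0 < f ((a, τ), (b, ω)) := by linarith
  have hLipR : |u₀ a - u₀ b| ≤ R * ‖a - b‖ :=
    (hLip a b).trans (mul_le_mul_of_nonneg_right hBR (norm_nonneg _))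
  -- At time 0 for either point, the speed bound M and the slope R ≥ B make f nonpositive.
  have hτpos : 0 < τ := by
    rcases hτ.eq_or_lt with rfl | h
    · have h1 := hfle a 0 b ω le_rfl
      have h2 := (abs_le.1 (hM b ω hω)).1
      have h3 := (abs_le.1 hLipR).2
      rw [hu.initial, zero_sub, abs_neg, abs_of_nonneg hω] at h1
      linarith
    · exact h
  have hωpos : 0 < ω := by
    rcases hω.eq_or_lt with rfl | h
    · have h1 := hfle a τ b 0 hτ
      have h2 := (abs_le.1 (hM a τ hτ)).2
      have h3 := (abs_le.1 hLipR).2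
      rw [hu.initial, sub_zero, abs_of_nonneg hτ] at h1
      have : 0 ≤ l * τ ^ 2 := by positivity
      linarith
    · exact h
  set P : ConfigSpace d := R • (√(κ ^ 2 + ‖a - b‖ ^ 2))⁻¹ • (a - b) with hP
  set r : ℝ := (τ - ω) / √(κ ^ 2 + (τ - ω) ^ 2) with hr
  have hr1 : |r| ≤ 1 := abs_div_sqrt_le_one κ (τ - ω)
  have hsub : (M * r + l * (1 + 2 * τ) + 2 * (τ - τ')) + F a (P + (2 : ℝ) • (a - c)) ≤ 0 := by
    have hd : HasDerivAt (fun t => l * (t + t ^ 2)) (l * (1 + 2 * τ)) τ := by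
      have := ((hasDerivAt_id τ).add ((hasDerivAt_id τ).pow 2)).const_mul l
      refine this.congr_deriv ?_
      simp
    have hd' : HasDerivAt (fun t => (t - τ') ^ 2) (2 * (τ - τ')) τ := by
      refine (((hasDerivAt_id τ).sub_const τ').pow 2).congr_deriv ?_
      simp
    refine hu.sub.le_zero (x₀ := a) (t₀ := τ)
      (a := fun z => R * √(κ ^ 2 + ‖z - b‖ ^ 2) + ‖z - c‖ ^ 2)
      (b := fun t => M * √(κ ^ 2 + (t - ω) ^ 2) + l * (t + t ^ 2) + (t - τ') ^ 2)
      ((contDiff_const.mul (contDiff_sqrt_normSq_sub hκ b)).add (contDiff_normSq_sub c))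
      (((contDiff_const.mul (contDiff_sqrt_sq_sub hκ ω)).add (by fun_prop)).add (by fun_prop))
      (((hasGradientAt_sqrt_normSq_sub hκ b a).const_mul' R).add' (hasGradientAt_normSq_sub c a))
      ((((hasDerivAt_sqrt_sq_sub hκ ω τ).const_mul M).add hd).add hd') hτpos ?_
    filter_upwards [prod_mem_nhds Filter.univ_mem (Ici_mem_nhds hτpos)] with q hq
    have := hmax (q, (b, ω)) ⟨hq, ⟨mem_univ _, hω⟩⟩
    simp only [hf] at this ⊢
    linarith
  have hsup : (-(M * r) + 2 * (ω - ω')) - F b (P - (2 : ℝ) • (b - e)) ≤ 0 := by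
    have hd' : HasDerivAt (fun t => (t - ω') ^ 2) (2 * (ω - ω')) ω := by
      refine (((hasDerivAt_id ω).sub_const ω').pow 2).congr_deriv ?_
      simp
    have key := hu.super.neg.le_zero (x₀ := b) (t₀ := ω)
      (a := fun z => R * √(κ ^ 2 + ‖z - a‖ ^ 2) + ‖z - e‖ ^ 2)
      (b := fun t => M * √(κ ^ 2 + (t - τ) ^ 2) + (t - ω') ^ 2)
      ((contDiff_const.mul (contDiff_sqrt_normSq_sub hκ a)).add (contDiff_normSq_sub e))
      ((contDiff_const.mul (contDiff_sqrt_sq_sub hκ τ)).add (by fun_prop))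
      (((hasGradientAt_sqrt_normSq_sub hκ a b).const_mul' R).add' (hasGradientAt_normSq_sub e b))
      (((hasDerivAt_sqrt_sq_sub hκ τ ω).const_mul M).add hd') hωpos (by
        filter_upwards [prod_mem_nhds Filter.univ_mem (Ici_mem_nhds hωpos)] with q hq
        have := hmax ((a, τ), q) ⟨⟨mem_univ _, hτ⟩, hq⟩
        simp only [hf] at this ⊢
        rw [norm_sub_rev q.1 a, norm_sub_rev b a, ← neg_sub τ q.2, ← neg_sub τ ω, neg_sq, neg_sq]
        linarith)
    have e1 : (ω - τ) / √(κ ^ 2 + (ω - τ) ^ 2) = -r := by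
      rw [hr, ← neg_sub τ ω, neg_sq, neg_div]
    have e2 : -(R • (√(κ ^ 2 + ‖b - a‖ ^ 2))⁻¹ • (b - a) + (2 : ℝ) • (b - e)) =
        P - (2 : ℝ) • (b - e) := by
      rw [hP, norm_sub_rev b a, ← neg_sub a b, smul_neg, smul_neg]
      abel
    rw [e1, e2] at key
    linarith
  have hn1 : ‖(2 : ℝ) • (a - c)‖ ≤ 2 * η := by
    rw [norm_smul, Real.norm_of_nonneg zero_le_two]; linarith
  have hn2 : ‖(2 : ℝ) • (b - e)‖ ≤ 2 * η := by
    rw [norm_smul, Real.norm_of_nonneg zero_le_two]; linarith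
  have hMr : -M ≤ M * r := by
    have := mul_le_mul_of_nonneg_left (abs_le.1 hr1).1 hM0
    linarith
  have hτη := (abs_le.1 hττ).1
  have hωη := (abs_le.1 hωω).1
  have hlτ : 0 ≤ l * τ := by positivity
  -- The time slope is at least −M − 2η, so F ≤ M + 1/2 at this momentum, and coercivity applies.
  have hp1 : ‖P + (2 : ℝ) • (a - c)‖ < R₀ := by
    by_contra! h
    have := hcoer a _ h
    linarith
  have hPn : ‖P‖ ≤ R₀ + 1 := by
    have := norm_sub_le (P + (2 : ℝ) • (a - c)) ((2 : ℝ) • (a - c))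
    rw [add_sub_cancel_right] at this
    linarith
  have hp2 : ‖P - (2 : ℝ) • (b - e)‖ < R₀ + 3 := by
    have := norm_sub_le P ((2 : ℝ) • (b - e))
    linarith
  have hab : ‖a - b‖ ≤ (R₀ + 1) * κ :=
    norm_le_of_norm_smul_inv_sqrt_le hκ (by linarith) (by linarith) hPn
  have hpp : ‖(P + (2 : ℝ) • (a - c)) - (P - (2 : ℝ) • (b - e))‖ ≤ 4 * η := by
    rw [show (P + (2 : ℝ) • (a - c)) - (P - (2 : ℝ) • (b - e)) =
      (2 : ℝ) • (a - c) + (2 : ℝ) • (b - e) by abel]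
    exact (norm_add_le _ _).trans (by linarith)
  -- Adding `hsub` and `hsup` cancels M r and leaves l ≤ 4η + L((R₀ + 1)κ + 4η) ≤ l/2.
  have hdiff := (abs_le.1 (hL a b (P + (2 : ℝ) • (a - c)) _ (by linarith) hp2)).1
  have hLle := mul_le_mul_of_nonneg_left (add_le_add hab hpp) hL0
  linarith

end Lipschitz

/-! ### Bounds on the Hamiltonian from periodicity. -/

section Lattice

variable {d : ℕ}

/-- Every configuration can be moved into a fixed ball by a lattice translation. -/
theorem exists_norm_add_lattice_le (d : ℕ) :
    ∃ C : ℝ, ∀ x : ConfigSpace d, ∃ z ∈ latticeSet d, ‖x + z‖ ≤ C := by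
  refine ⟨measureUnivNNReal (volume : Measure (Label d)) ^ (2 : ENNReal).toReal⁻¹ * √d, fun x => ?_⟩
  let y : Label d → EuclideanSpace ℝ (Fin d) := fun i => WithLp.toLp 2 fun k => Int.fract (x i k)
  have hx : Measurable x := (Lp.stronglyMeasurable x).measurable
  have hym : Measurable y := (WithLp.measurable_toLp 2 _).comp (measurable_pi_lambda _ fun k =>
    measurable_fract.comp ((measurable_pi_apply k).comp ((WithLp.measurable_ofLp 2 _).comp hx)))
  have hyb : ∀ i, ‖y i‖ ≤ √d := fun i => by
    rw [EuclideanSpace.norm_eq]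
    refine Real.sqrt_le_sqrt ?_
    calc ∑ k, ‖y i k‖ ^ 2 ≤ ∑ _k : Fin d, (1 : ℝ) := Finset.sum_le_sum fun k _ => by
          have h0 := Int.fract_nonneg (x i k)
          have h1 := (Int.fract_lt_one (x i k)).le
          change ‖Int.fract (x i k)‖ ^ 2 ≤ 1
          rw [Real.norm_of_nonneg h0]
          exact pow_le_one₀ h0 h1
      _ = d := by simp
  have hy : MemLp y 2 volume :=
    MemLp.of_bound hym.aestronglyMeasurable √d (Filter.Eventually.of_forall hyb)
  -- The translation is −⌊x⌋ taken coordinatewise, leaving the fractional part, of pointwise norm at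
  -- most √d.
  refine ⟨hy.toLp y - x, ?_, ?_⟩
  · filter_upwards [Lp.coeFn_sub (hy.toLp y) x, hy.coeFn_toLp] with i h1 h2 k
    refine ⟨-⌊x i k⌋, ?_⟩
    rw [h1, Pi.sub_apply, h2]
    change Int.fract (x i k) - x i k = _
    rw [Int.fract]
    push_cast
    ring
  · rw [add_sub_cancel]
    refine Lp.norm_le_of_ae_bound (Real.sqrt_nonneg _) ?_
    filter_upwards [hy.coeFn_toLp] with i hi
    rw [hi]
    exact hyb i

variable {H : ConfigSpace d → ConfigSpace d → ℝ}

/-- A Hamiltonian satisfying `(H3)` obeys a two-variable Lipschitz estimate for bounded momenta. -/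
theorem IsLipschitzOnBoundedMomenta.exists_abs_sub_le (hH : IsLipschitzOnBoundedMomenta H) (r : ℝ) :
    ∃ L : ℝ, 0 ≤ L ∧ ∀ x y p q, ‖p‖ < r → ‖q‖ < r →
      |H x p - H y q| ≤ L * (‖x - y‖ + ‖p - q‖) := by
  obtain ⟨L, hL⟩ := hH (max r 1) (by positivity)
  refine ⟨L, L.2, fun x y p q hp hq => ?_⟩
  have h := hL.dist_le_mul (x, p) ⟨mem_univ _, by simpa using Or.inl hp⟩ (y, q)
    ⟨mem_univ _, by simpa using Or.inl hq⟩
  rw [Real.dist_eq, Prod.dist_eq, dist_eq_norm, dist_eq_norm] at h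
  refine h.trans (mul_le_mul_of_nonneg_left ?_ L.2)
  exact max_le (by linarith [norm_nonneg (p - q)]) (by linarith [norm_nonneg (x - y)])

/-- A lattice-periodic Hamiltonian satisfying `(H3)` is bounded for bounded momenta. -/
theorem IsLatticePeriodic.exists_abs_le (h1 : IsLatticePeriodic H)
    (h3 : IsLipschitzOnBoundedMomenta H) (r : ℝ) : ∃ m : ℝ, ∀ x p, ‖p‖ ≤ r → |H x p| ≤ m := by
  obtain ⟨C, hC⟩ := exists_norm_add_lattice_le d
  obtain ⟨L, hL0, hL⟩ := h3.exists_abs_sub_le (|r| + 1)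
  refine ⟨|H 0 0| + L * (C + |r|), fun x p hp => ?_⟩
  obtain ⟨z, hz, hxz⟩ := hC x
  have hpr := hp.trans (le_abs_self r)
  have h := hL (x + z) 0 p 0 (by linarith) (by rw [norm_zero]; positivity)
  rw [sub_zero, sub_zero, h1 x p z hz] at h
  have h' := abs_sub_abs_le_abs_sub (H x p) (H 0 0)
  have := mul_le_mul_of_nonneg_left (add_le_add hxz hpr) hL0
  linarith

end Lattice

/-! ### Assembly, with constants chosen before ε. -/

theorem proposition2p3 (d : ℕ) (H : ConfigSpace d → ConfigSpace d → ℝ)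
    (u₀ : ConfigSpace d → ℝ)
    (hH1 : IsLatticePeriodic H) (hH2 : IsRearrangementInvariant H)
    (hH3 : IsLipschitzOnBoundedMomenta H) (hH4 : IsCoerciveHamiltonian H)
    (hI1 : DependsOnMean u₀) (hI2 : IsCb1 u₀) :
    ∃ C : ℝ, 0 < C ∧ ∀ ε : ℝ, 0 < ε → ∀ u : ConfigSpace d → ℝ → ℝ,
      IsViscositySolution (fun x p => H (ε⁻¹ • x) p) u₀ u → HasLinearGrowth u →
        ∀ (x y : ConfigSpace d) (s t : ℝ), 0 ≤ s → 0 ≤ t →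
          |u x t - u y s| ≤ C * (‖x - y‖ + |t - s|) := by
  obtain ⟨hC1, ⟨B₀, hB₀⟩, ⟨B, hB⟩⟩ := hI2
  have hLip : ∀ x y, |u₀ x - u₀ y| ≤ B * ‖x - y‖ := fun x y =>
    convex_univ.norm_image_sub_le_of_norm_fderiv_le
      (fun z _ => hC1.differentiable one_ne_zero z) (fun z _ => hB z) (mem_univ y) (mem_univ x)
  have hB0 : 0 ≤ B := (norm_nonneg _).trans (hB 0)
  -- The extra 1 leaves room for the gradient of the quadratic perturbation.
  obtain ⟨M, hM⟩ := hH1.exists_abs_le hH3 (B + 1)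
  have hM0 : 0 ≤ M := (abs_nonneg _).trans (hM 0 0 (by rw [norm_zero]; positivity))
  obtain ⟨R₁, hR₁⟩ := hH4 (M + 2)
  have hcoer : ∀ x p, max R₁ 0 ≤ ‖p‖ → M + 1 < H x p := fun x p hp => by
    linarith [hR₁ p ((le_max_left _ _).trans hp) x]
  -- R dominates the slope of u₀ and exceeds the coercivity radius by the margin that the doubling
  -- needs.
  set R := max B (max R₁ 0 + 2) with hR
  have hR0 : 0 ≤ R := hB0.trans (le_max_left _ _)
  refine ⟨M + R + 1, by positivity, fun ε hε u hu hg => ?_⟩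
  have hspeed : ∀ x t, 0 ≤ t → |u x t - u₀ x| ≤ M * t := fun x t ht =>
    hu.abs_sub_initial_le hg hC1 hB₀ hB
      (fun r => (hH1.exists_abs_le hH3 r).imp fun m hm x p hp => hm _ p hp) hM0
      (fun x p hp => hM _ p hp) ht
  have hF : ∀ r : ℝ, ∃ L : ℝ, 0 ≤ L ∧ ∀ x y p q : ConfigSpace d, ‖p‖ < r → ‖q‖ < r →
      |H (ε⁻¹ • x) p - H (ε⁻¹ • y) q| ≤ L * (‖x - y‖ + ‖p - q‖) := fun r => by
    obtain ⟨L, hL0, hL⟩ := hH3.exists_abs_sub_le r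
    refine ⟨L * (ε⁻¹ + 1), by positivity, fun x y p q hp hq => (hL _ _ p q hp hq).trans ?_⟩
    rw [← smul_sub, norm_smul, Real.norm_of_nonneg (by positivity), mul_assoc]
    refine mul_le_mul_of_nonneg_left ?_ hL0
    have : 0 ≤ ε⁻¹ * ‖p - q‖ := by positivity
    linarith [norm_nonneg (x - y)]
  have hone : ∀ (x y : ConfigSpace d) (s t : ℝ), 0 ≤ s → 0 ≤ t →
      u x t - u y s ≤ (M + R + 1) * (‖x - y‖ + |t - s|) := fun x y s t hs ht => by
    have h := hu.sub_le hB₀ hLip hM0 hspeed (le_max_right R₁ 0) (fun x p => hcoer _ p) hF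
      (le_max_left _ _) (le_max_right _ _) (x := x) (y := y) ht hs
    have h1 := norm_nonneg (x - y)
    have h2 := abs_nonneg (t - s)
    have h3 := mul_nonneg hM0 h1
    have h4 := mul_nonneg hR0 h2
    linarith
  intro x y s t hs ht
  refine abs_sub_le_iff.2 ⟨hone x y s t hs ht, ?_⟩
  rw [norm_sub_rev, abs_sub_comm]
  exact hone y x t s ht hs
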